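/- **Setting.** Let $\ell\in(0,\infty]$, $I=[-\ell/2,\ell/2]$ ($I=\mathbb R$ if $\ell=\infty$), and let $\mathfrak F$ be the bosonic Fock space over $L^2(I)$, with vacuum $|\Omega\rangle$ and field operators $\psi(x),\psi^\dagger(x)$. For matrix functions $Q,L,R,T:I\to M_d(\mathbb C)$ and $B\in M_d(\mathbb C)$, a bounded operator $O$ on $\mathfrak F$ is the cMPO with tensors $(B,Q,L,R,T)$ and bond dimension $d$ if $$O=\mathrm{Tr}_d\Big(B\,\mathcal P e^{\int_I dx\,(Q(x)\otimes \mathrm{Id}+L(x)\otimes l_x+R(x)\otimes r_x+T(x)\otimes \mathrm{Ad}_x)}\Big)(|\Omega\rangle\langle\Omega|),$$ $$l_x[X]=\psi^\dagger(x)X,\qquad r_x[X]=X\psi(x),\qquad \mathrm{Ad}_x[X]=\psi^\dagger(x)X\psi(x),$$ where the path-ordered exponential is its Dyson series (integrals over $x_1<\dots<x_n$ in $I$), in the sense of matrix elements between states of finite particle number. A *phase cMPU* with tensors $(B,Q,T)$ is a unitary $U$ that is the cMPO with these tensors and $L=R=0$, such that for all $j\ge 0$ and all $x_1<\dots<x_j$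 in $I$ the coefficient $\mathrm{Tr}(BV_-^1T(x_1)V_1^2\cdots T(x_j)V_j^+)$ is a complex phase. Here $V_i^{i+1}=\mathcal P\exp\int_{x_i}^{x_{i+1}}Q$, and $V_-^1$, $V_j^+$ are the propagators from the left end of $I$ to $x_1$ and from $x_j$ to the right end. It is *bulk-uniform* if $Q$ and $T$ do not depend on $x$. **Proposition.** Let $D\ge 2$ and $\theta\in\mathbb R$. Let $J^-$ be the lowering operator of $\mathfrak{su}(2)$ in its $D$-dimensional irreducible representation, in the standard basis $|j,j\rangle,|j,j-1\rangle,\dots,|j,-j\rangle$ with $j=(D-1)/2$ and $J^-|j,m\rangle=\sqrt{j(j+1)-m(m-1)}\,|j,m-1\rangle$. Let $N_D$ be the nilpotent shift $(N_D)_{ab}=\delta_{a+1,b}$. Put $$B=1\oplus\frac{e^{i\theta}-1}{(D-1)!}(J^-)^{D-1},\qquad Q=0,\qquad T=1\oplus N_D .$$ Equivalently, $B=1\oplus(e^{i\theta}-1)(N_D^{\mathsf T})^{D-1}$. Then, for every $\ell\in(0,\infty]$, these tensors define a unique bounded cMPO $U$ on $\mathfrak F$, and $U$ is a bulk-uniform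 phase cMPU of bond dimension $D+1$ with these tensors. For every $g\in GL_{D+1}(\mathbb C)$ the gauge-transformed tensors $(gBg^{-1},0,gTg^{-1})$ are also tensors of $U$ as a bulk-uniform phase cMPU. Moreover $$U=\mathbb 1+(e^{i\theta}-1)P_{D-1},\qquad P_{D-1}=\int_{x_1<\dots<x_{D-1}}\!\!\!dx\;\psi^\dagger(x_1)\cdots\psi^\dagger(x_{D-1})|\Omega\rangle\langle\Omega|\psi(x_{D-1})\cdots\psi(x_1),$$ where $P_{D-1}$ is the orthogonal projector onto the $(D-1)$-particle sector and the integral is over $I$, in the sense of matrix elements. So $U$ multiplies the $(D-1)$-particle sector by $e^{i\theta}$ and acts as the identity on every other sector. -/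

import Mathlib

open MeasureTheory
open scoped ENNReal

noncomputable section

namespace CMPO

/-! ### The bosonic Fock space over an interval -/

/-- The interval `[-ℓ/2, ℓ/2]` of length `ℓ ∈ [0, ∞]`; it is the whole line for `ℓ = ∞`. -/
def box (ℓ : ℝ≥0∞) : Set ℝ := {x | ENNReal.ofReal (2 * |x|) ≤ ℓ}

/-- Lebesgue measure on the `n`-fold power of the interval. -/
abbrev boxMeasure (ℓ : ℝ≥0∞) (n : ℕ) : Measure (Fin n → ℝ) :=
  Measure.pi fun _ => volume.restrict (box ℓ)

theorem measurePreserving_permute (ℓ : ℝ≥0∞) {n : ℕ} (σ : Equiv.Perm (Fin n)) :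
    MeasurePreserving (fun x : Fin n → ℝ => x ∘ σ) (boxMeasure ℓ n) (boxMeasure ℓ n) := by
  have h := measurePreserving_piCongrLeft
    (fun _ : Fin n => (volume : Measure ℝ).restrict (box ℓ)) σ.symm
  convert h using 1
  funext x i
  have := MeasurableEquiv.piCongrLeft_apply_apply (β := fun _ : Fin n => ℝ) σ.symm x (σ i)
  simp only [Equiv.symm_apply_apply] at this
  simp [this]

/-- The action of a permutation of the coordinates on `L²` of the `n`-fold interval. -/
def permute (ℓ : ℝ≥0∞) {n : ℕ} (σ : Equiv.Perm (Fin n)) :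
    Lp ℂ 2 (boxMeasure ℓ n) →ₗᵢ[ℂ] Lp ℂ 2 (boxMeasure ℓ n) :=
  Lp.compMeasurePreservingₗᵢ ℂ (fun x : Fin n → ℝ => x ∘ σ) (measurePreserving_permute ℓ σ)

/-- The `n`-particle space: the symmetric square integrable wavefunctions of `n` variables. -/
def nParticle (ℓ : ℝ≥0∞) (n : ℕ) : Submodule ℂ (Lp ℂ 2 (boxMeasure ℓ n)) where
  carrier := {f | ∀ σ : Equiv.Perm (Fin n), permute ℓ σ f = f}
  add_mem' hf hg σ := by rw [map_add, hf σ, hg σ]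
  zero_mem' σ := map_zero _
  smul_mem' c f hf σ := by rw [map_smul, hf σ]

instance (ℓ : ℝ≥0∞) (n : ℕ) : CompleteSpace (nParticle ℓ n) := by
  have h : IsClosed (nParticle ℓ n : Set (Lp ℂ 2 (boxMeasure ℓ n))) := by
    have : (nParticle ℓ n : Set (Lp ℂ 2 (boxMeasure ℓ n))) =
        ⋂ σ : Equiv.Perm (Fin n), {f | permute ℓ σ f = f} := by
      ext f
      simp [nParticle]
    rw [this]
    exact isClosed_iInter fun σ => isClosed_eq (permute ℓ σ).continuous continuous_id
  exact h.completeSpace_coe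

/-- The bosonic Fock space: the Hilbert sum of the `n`-particle spaces. -/
abbrev Fock (ℓ : ℝ≥0∞) : Type := lp (fun n : ℕ => nParticle ℓ n) 2

/-- A Fock state of finite total particle number. -/
def FiniteParticle {ℓ : ℝ≥0∞} (Φ : Fock ℓ) : Prop := {n : ℕ | Φ n ≠ 0}.Finite

/-- The amplitude `⟨Ω| ψ(y₁) ⋯ ψ(y_k) |Φ⟩`, which is `√(k!)` times the `k`-particle wavefunction
of `Φ` at `(y₁, …, y_k)`. Its conjugate is `⟨Φ| ψ†(y₁) ⋯ ψ†(y_k) |Ω⟩`. -/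
def amplitude {ℓ : ℝ≥0∞} (Φ : Fock ℓ) {k : ℕ} (y : Fin k → ℝ) : ℂ :=
  (Real.sqrt k.factorial : ℂ) * (Φ k : Lp ℂ 2 (boxMeasure ℓ k)) y

/-- The `k`-particle sector of Fock space. -/
def sector (ℓ : ℝ≥0∞) (k : ℕ) : Submodule ℂ (Fock ℓ) where
  carrier := {Φ | ∀ n, n ≠ k → Φ n = 0}
  add_mem' hf hg n hn := by simp [hf n hn, hg n hn]
  zero_mem' n _ := by simp
  smul_mem' c f hf n hn := by simp [hf n hn]

instance (ℓ : ℝ≥0∞) (k : ℕ) : CompleteSpace (sector ℓ k) := by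
  have h : IsClosed (sector ℓ k : Set (Fock ℓ)) := by
    have : (sector ℓ k : Set (Fock ℓ)) = ⋂ n : ℕ, ⋂ _ : n ≠ k, {Φ : Fock ℓ | Φ n = 0} := by
      ext Φ
      simp only [Set.mem_iInter]
      exact Iff.rfl
    rw [this]
    refine isClosed_iInter fun n => isClosed_iInter fun _ => isClosed_eq ?_ continuous_const
    exact (lp.evalCLM ℂ (fun n : ℕ => nParticle ℓ n) 2 n).continuous
  exact h.completeSpace_coe

/-- The orthogonal projector onto the `k`-particle sector. -/
def sectorProj (ℓ : ℝ≥0∞) (k : ℕ) : Fock ℓ →L[ℂ] Fock ℓ := (sector ℓ k).starProjection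

/-- The operator `P` is `∫ Dᵏx Ad_xᵏ(|Ω⟩⟨Ω|)`, that is, the integral over `x₁ < ⋯ < x_k` in the
interval of `ψ†(x₁) ⋯ ψ†(x_k) |Ω⟩⟨Ω| ψ(x_k) ⋯ ψ(x₁)`, in the sense of matrix elements. -/
def IsOrderedAd (ℓ : ℝ≥0∞) (k : ℕ) (P : Fock ℓ →L[ℂ] Fock ℓ) : Prop :=
  ∀ Ψ Φ : Fock ℓ,
    IntegrableOn (fun x : Fin k → ℝ => (starRingEnd ℂ) (amplitude Ψ x) * amplitude Φ x)
      {x | StrictMono x} (boxMeasure ℓ k) ∧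
    inner ℂ Ψ (P Φ) = ∫ x in {x : Fin k → ℝ | StrictMono x},
      (starRingEnd ℂ) (amplitude Ψ x) * amplitude Φ x ∂(boxMeasure ℓ k)

/-! ### Continuous matrix product operators -/

/-- The four terms of `𝔏_x = Q(x) ⊗ Id + L(x) ⊗ l_x + R(x) ⊗ r_x + T(x) ⊗ Ad_x`. -/
inductive Letter where
  | Q | L | R | T

/-- Does the supermap multiply by `ψ†(x)` from the left? -/
def Letter.creates : Letter → Bool
  | .Q => false
  | .L => true
  | .R => false
  | .T => true

/-- Does the supermap multiply by `ψ(x)` from the right? -/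
def Letter.annihilates : Letter → Bool
  | .Q => false
  | .L => false
  | .R => true
  | .T => true

/-- The bond matrix that multiplies the supermap. -/
def Letter.bond {ι : Type} (Q L R T : ℝ → Matrix ι ι ℂ) : Letter → ℝ → Matrix ι ι ℂ
  | .Q => Q
  | .L => L
  | .R => R
  | .T => T

/-- The coordinates of `x` at the positions in `s`, in increasing order of the positions. -/
def subTuple {n : ℕ} (x : Fin n → ℝ) (s : Finset (Fin n)) : Fin s.card → ℝ :=
  fun i => x (s.orderEmbOfFin rfl i)

/-- The integrand of the matrix element `⟨Ψ| · |Φ⟩` of the Dyson term of a word `α`: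
`Tr(B K^{α₁}(x₁) ⋯ K^{αₙ}(xₙ)) ⟨Ψ| ∏ ψ†(x_i) |Ω⟩⟨Ω| ∏ ψ(x_j) |Φ⟩`, with `i` over the positions of
the letters `L`, `T` and `j` over those of the letters `R`, `T`. -/
def dysonIntegrand {ℓ : ℝ≥0∞} {ι : Type} [Fintype ι] [DecidableEq ι]
    (B : Matrix ι ι ℂ) (Q L R T : ℝ → Matrix ι ι ℂ) (Ψ Φ : Fock ℓ)
    {n : ℕ} (α : Fin n → Letter) (x : Fin n → ℝ) : ℂ :=
  (B * (List.ofFn fun i => (α i).bond Q L R T (x i)).prod).trace *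
    ((starRingEnd ℂ) (amplitude Ψ (subTuple x {i | (α i).creates})) *
      amplitude Φ (subTuple x {i | (α i).annihilates}))

/-- `O = Tr (B 𝒫exp(∫ 𝔏_x dx)) (|Ω⟩⟨Ω|)`: the matrix elements of `O` between states of finite
particle number are given by the Dyson series of the path-ordered exponential, a sum over words
of integrals over ordered points `x₁ < ⋯ < xₙ` of the interval. -/
def IsCMPO {ι : Type} [Fintype ι] [DecidableEq ι] (ℓ : ℝ≥0∞)
    (B : Matrix ι ι ℂ) (Q L R T : ℝ → Matrix ι ι ℂ) (O : Fock ℓ →L[ℂ] Fock ℓ) : Prop :=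
  ∀ Ψ Φ : Fock ℓ, FiniteParticle Ψ → FiniteParticle Φ →
    (∀ (n : ℕ) (α : Fin n → Letter),
      IntegrableOn (dysonIntegrand B Q L R T Ψ Φ α) {x | StrictMono x} (boxMeasure ℓ n)) ∧
    HasSum (fun w : (n : ℕ) × (Fin n → Letter) =>
        ∫ x in {x : Fin w.1 → ℝ | StrictMono x},
          dysonIntegrand B Q L R T Ψ Φ w.2 x ∂(boxMeasure ℓ w.1))
      (inner ℂ Ψ (O Φ))

/-- The free propagator: the path-ordered exponential of `∫ Q` over the set `S` (an interval in
every use below), as its Dyson series, entry by entry. -/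
def propagator {ι : Type} [Fintype ι] [DecidableEq ι] (Q : ℝ → Matrix ι ι ℂ) (S : Set ℝ) :
    Matrix ι ι ℂ :=
  Matrix.of fun a b => ∑' n : ℕ, ∫ x in {x : Fin n → ℝ | StrictMono x ∧ ∀ i, x i ∈ S},
    (List.ofFn fun i => Q (x i)).prod a b

/-- The continuous matrix product coefficient
`Tr(B V_-^1 T(x₁) V_1^2 ⋯ V_{j-1}^j T(x_j) V_j^+)` at points `x₁ < ⋯ < x_j` of the interval. -/
def phaseCoeff {ι : Type} [Fintype ι] [DecidableEq ι] (ℓ : ℝ≥0∞)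
    (B : Matrix ι ι ℂ) (Q T : ℝ → Matrix ι ι ℂ) {j : ℕ} (x : Fin j → ℝ) : ℂ :=
  (B * (List.ofFn fun i =>
      propagator Q {z | z ∈ box ℓ ∧ z < x i ∧ ∀ k < i, x k < z} * T (x i)).prod *
    propagator Q {z | z ∈ box ℓ ∧ ∀ k, x k < z}).trace

/-- `U` is a phase cMPU with tensors `B, Q, T`: it is unitary, it is the cMPO with these tensors
and `L = R = 0`, and all its continuous matrix product coefficients are complex phases. -/
structure IsPhaseCMPU {ι : Type} [Fintype ι] [DecidableEq ι] (ℓ : ℝ≥0∞)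
    (B : Matrix ι ι ℂ) (Q T : ℝ → Matrix ι ι ℂ) (U : Fock ℓ →L[ℂ] Fock ℓ) : Prop where
  mem_unitary : U ∈ unitary (Fock ℓ →L[ℂ] Fock ℓ)
  isCMPO : IsCMPO ℓ B Q (fun _ => 0) (fun _ => 0) T U
  isPhase : ∃ φ : (j : ℕ) → (Fin j → ℝ) → ℝ, ∀ (j : ℕ) (x : Fin j → ℝ),
    (∀ i, x i ∈ box ℓ) → StrictMono x →
      phaseCoeff ℓ B Q T x = Complex.exp (Complex.I * (φ j x : ℂ))

/-- A phase cMPU of bond dimension `d` whose bulk tensors `Q, T` do not depend on the position. -/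
def IsBulkUniformPhaseCMPU (d : ℕ) (ℓ : ℝ≥0∞) (B Q T : Matrix (Fin d) (Fin d) ℂ)
    (U : Fock ℓ →L[ℂ] Fock ℓ) : Prop :=
  IsPhaseCMPU ℓ B (fun _ => Q) (fun _ => T) U

/-! ### The number-controlled phase tensors -/

/-- The direct sum `1 ⊕ X` of the scalar `1` and a `D × D` matrix. -/
def oneOplus {D : ℕ} (X : Matrix (Fin D) (Fin D) ℂ) : Matrix (Fin (D + 1)) (Fin (D + 1)) ℂ :=
  Matrix.reindex (finSumFinEquiv.trans (finCongr (Nat.add_comm 1 D)))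
    (finSumFinEquiv.trans (finCongr (Nat.add_comm 1 D)))
    (Matrix.fromBlocks (1 : Matrix (Fin 1) (Fin 1) ℂ) 0 0 X)

/-- The lowering operator `J⁻` of `𝔰𝔲(2)` in its `D`-dimensional irreducible representation of spin
`j = (D - 1) / 2`, in the basis `|j, j - b⟩`, `b = 0, …, D - 1`:
`J⁻ |j, m⟩ = √(j (j + 1) - m (m - 1)) |j, m - 1⟩`. -/
def spinLowering (D : ℕ) : Matrix (Fin D) (Fin D) ℂ := fun a b =>
  if (a : ℕ) = b + 1 then
    let j : ℝ := ((D : ℝ) - 1) / 2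
    let m : ℝ := j - (b : ℕ)
    (Real.sqrt (j * (j + 1) - m * (m - 1)) : ℂ)
  else 0

/-- The nilpotent shift `N_D`, with ones just above the diagonal: `|b⟩ ↦ |b - 1⟩`. -/
def nilShift (D : ℕ) : Matrix (Fin D) (Fin D) ℂ := fun a b =>
  if (b : ℕ) = a + 1 then 1 else 0

/-- The bulk matrix `T = 1 ⊕ N_D`. -/
def numberBulk (D : ℕ) : Matrix (Fin (D + 1)) (Fin (D + 1)) ℂ := oneOplus (nilShift D)

/-- The boundary matrix `B = 1 ⊕ (e^{iθ} - 1) (J⁻)^{D-1} / (D-1)!`. -/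
def numberBoundary (D : ℕ) (θ : ℝ) : Matrix (Fin (D + 1)) (Fin (D + 1)) ℂ :=
  oneOplus (((Complex.exp (Complex.I * θ) - 1) / ((D - 1).factorial : ℂ)) •
    spinLowering D ^ (D - 1))

end CMPO

end

namespace CMPO

/-! ### Traces of the tensors -/

/-! With `Q = L = R = 0`, a word of the Dyson series vanishes unless all its letters are `T`. The
ordered integral of the word `Tⁿ` is the projector onto the `n`-particle sector
(`setIntegral_amplitude_mul`), so the cMPO is diagonal with eigenvalue `Tr(B Tⁿ)` on that sector
(`hasSum_dyson_iff`). The tensors enter only through these traces, which are gauge invariant.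

The scalar block of `1 ⊕ N_D` contributes `1` to every trace. In the other block `(N_Dᵀ)^(D-1)` is a
single corner matrix unit, which pairs with `N_Dⁿ` only for `n = D - 1` and adds `e^{iθ} - 1` there
(`trace_number`). The eigenvalues are thus phases, which gives unitarity. Uniqueness holds because
states of finite particle number are dense (`IsCMPO.unique`). -/

theorem oneOplus_mul {D : ℕ} (X Y : Matrix (Fin D) (Fin D) ℂ) :
    oneOplus X * oneOplus Y = oneOplus (X * Y) := by
  simp only [oneOplus, Matrix.reindex_apply, Matrix.submatrix_mul_equiv,
    Matrix.fromBlocks_multiply]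
  simp

theorem oneOplus_one {D : ℕ} : oneOplus (1 : Matrix (Fin D) (Fin D) ℂ) = 1 := by
  simp only [oneOplus, Matrix.fromBlocks_one, Matrix.reindex_apply, Matrix.submatrix_one_equiv]

theorem oneOplus_pow {D : ℕ} (X : Matrix (Fin D) (Fin D) ℂ) (k : ℕ) :
    oneOplus X ^ k = oneOplus (X ^ k) := by
  induction k with
  | zero => simp [oneOplus_one]
  | succ k ih => rw [pow_succ, ih, oneOplus_mul, pow_succ]

theorem trace_oneOplus {D : ℕ} (X : Matrix (Fin D) (Fin D) ℂ) :
    (oneOplus X).trace = 1 + X.trace := by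
  simp only [oneOplus, Matrix.reindex_apply, Matrix.trace, Matrix.diag_apply,
    Matrix.submatrix_apply]
  rw [Equiv.sum_comp (finSumFinEquiv.trans (finCongr (Nat.add_comm 1 D))).symm
    (fun i => Matrix.fromBlocks (1 : Matrix (Fin 1) (Fin 1) ℂ) 0 0 X i i)]
  simp

/-- Powers of a matrix supported on the first lower diagonal. -/
theorem lowerShift_pow {D : ℕ} (w : ℕ → ℂ) (W : Matrix (Fin D) (Fin D) ℂ)
    (hW : ∀ a b : Fin D, W a b = if (a : ℕ) = b + 1 then w b else 0) (k : ℕ) (a b : Fin D) :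
    (W ^ k) a b = if (a : ℕ) = b + k then ∏ i ∈ Finset.range k, w (b + i) else 0 := by
  induction k generalizing a with
  | zero => simp [Matrix.one_apply, Fin.ext_iff]
  | succ k ih =>
    rw [pow_succ', Matrix.mul_apply]
    simp only [hW, ih]
    split_ifs with h
    · have hk : (b : ℕ) + k < D := by have := a.2; omega
      rw [Finset.sum_eq_single ⟨b + k, hk⟩]
      · simp [h, Finset.prod_range_succ, mul_comm, add_assoc]
      · intro c _ hc
        have hc' : (c : ℕ) ≠ b + k := fun h' => hc (Fin.ext h')
        simp [hc']
      · simp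
    · refine Finset.sum_eq_zero fun c _ => ?_
      by_cases hc : (c : ℕ) = b + k
      · have : ¬ (a : ℕ) = c + 1 := by omega
        simp [this]
      · simp [hc]

theorem nilShift_transpose_pow {D : ℕ} (k : ℕ) (a b : Fin D) :
    ((nilShift D).transpose ^ k) a b = if (a : ℕ) = b + k then 1 else 0 := by
  rw [lowerShift_pow (fun _ => 1) (nilShift D).transpose (fun a b => by
    simp [nilShift, Matrix.transpose_apply])]
  simp

/-- These are the ladder coefficients from highest to lowest weight: for `j = n/2` and `m = j - i`,
`j(j+1) - m(m-1) = (n-i)(i+1)`. Each of the two factors runs through `1, …, n`, so the radicands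
multiply to `(n!)²`. -/
theorem prod_sqrt_eq_factorial (n : ℕ) :
    ∏ i ∈ Finset.range n, Real.sqrt (((n : ℝ) - i) * (i + 1)) = n.factorial := by
  have h1 : ∏ i ∈ Finset.range n, ((i : ℝ) + 1) = n.factorial := by
    rw [← Finset.prod_range_add_one_eq_factorial]; push_cast; rfl
  have h2 : ∏ i ∈ Finset.range n, ((n : ℝ) - i) = n.factorial := by
    rw [← h1, ← Finset.prod_range_reflect]
    refine Finset.prod_congr rfl fun i hi => ?_
    have hi' := Finset.mem_range.1 hi
    have : n - 1 - i + 1 + i = n := by omega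
    have h := congrArg (Nat.cast (R := ℝ)) this
    push_cast at h
    linarith
  rw [← Real.sqrt_prod, Finset.prod_mul_distrib, h1, h2, Real.sqrt_mul_self (by positivity)]
  intro i hi
  have : (i : ℝ) ≤ n := by exact_mod_cast (Finset.mem_range.1 hi).le
  have : 0 ≤ (n : ℝ) - i := by linarith
  positivity

theorem spinLowering_pow (n : ℕ) :
    spinLowering (n + 1) ^ n = (n.factorial : ℂ) • (nilShift (n + 1)).transpose ^ n := by
  ext a b
  rw [lowerShift_pow (fun b => (Real.sqrt (((n : ℝ) - b) * (b + 1)) : ℂ)) (spinLowering (n + 1))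
    (fun a b => ?_), Matrix.smul_apply, nilShift_transpose_pow]
  · split_ifs with h
    -- The `n`-th power has only its bottom-left entry, so all ladder coefficients are multiplied.
    · have hb : (b : ℕ) = 0 := by have := a.2; omega
      have := congrArg (fun r : ℝ => (r : ℂ)) (prod_sqrt_eq_factorial n)
      push_cast at this
      simpa [hb] using this
    · simp
  · simp only [spinLowering]
    congr 3
    push_cast
    ring

theorem numberBoundary_eq (n : ℕ) (θ : ℝ) :
    numberBoundary (n + 1) θ = oneOplus ((Complex.exp (Complex.I * θ) - 1) •
      (nilShift (n + 1)).transpose ^ n) := by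
  have hn : (n.factorial : ℂ) ≠ 0 := by exact_mod_cast n.factorial_ne_zero
  simp only [numberBoundary, Nat.add_sub_cancel, spinLowering_pow, smul_smul]
  rw [div_mul_cancel₀ _ hn]

/-- The trace is the entrywise pairing of the `n`-th and `k`-th subdiagonals. They are disjoint for
`k ≠ n`, and the `n`-th consists of one entry. -/
theorem trace_nilShift (n k : ℕ) :
    ((nilShift (n + 1)).transpose ^ n * nilShift (n + 1) ^ k).trace = if k = n then 1 else 0 := by
  have h : nilShift (n + 1) ^ k = ((nilShift (n + 1)).transpose ^ k).transpose := by
    rw [Matrix.transpose_pow, Matrix.transpose_transpose]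
  simp only [h, Matrix.trace, Matrix.diag_apply, Matrix.mul_apply, Matrix.transpose_apply,
    nilShift_transpose_pow]
  split_ifs with hk
  · subst hk
    rw [Finset.sum_eq_single (Fin.last k), Finset.sum_eq_single 0]
    · simp
    · intro b _ hb
      have hb' : (b : ℕ) ≠ 0 := fun h' => hb (Fin.ext h')
      simp [hb']
    · simp
    · intro a _ ha
      have ha' : (a : ℕ) ≠ k := fun h' => ha (Fin.ext h')
      refine Finset.sum_eq_zero fun b _ => ?_
      have : ¬ (a : ℕ) = b + k := by have := a.2; omega
      simp [this]
    · simp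
  · refine Finset.sum_eq_zero fun a _ => Finset.sum_eq_zero fun b _ => ?_
    split_ifs <;> first | omega | simp

/-- The phase acquired by the `k`-particle sector. -/
theorem trace_number (n k : ℕ) (θ : ℝ) :
    (numberBoundary (n + 1) θ * numberBulk (n + 1) ^ k).trace =
      if k = n then Complex.exp (Complex.I * θ) else 1 := by
  rw [numberBoundary_eq, numberBulk, oneOplus_pow, oneOplus_mul, trace_oneOplus,
    Matrix.smul_mul, Matrix.trace_smul, trace_nilShift]
  split_ifs <;> simp

theorem trace_conj_mul_pow {ι : Type} [Fintype ι] [DecidableEq ι]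
    (g : Matrix.GeneralLinearGroup ι ℂ) (B T : Matrix ι ι ℂ) (k : ℕ) :
    (g.val * B * g⁻¹.val * (g.val * T * g⁻¹.val) ^ k).trace = (B * T ^ k).trace := by
  have h : g.val * B * g⁻¹.val * (g.val * T * g⁻¹.val) ^ k
      = g.val * (B * T ^ k) * g⁻¹.val := by
    rw [Units.conj_pow]
    simp only [mul_assoc, Units.inv_mul_cancel_left]
  rw [h, Matrix.trace_mul_comm, ← mul_assoc]
  simp

/-! ### Integrals over ordered points -/

theorem measurableSet_strictMono (n : ℕ) :
    MeasurableSet {x : Fin n → ℝ | StrictMono x} := by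
  have : {x : Fin n → ℝ | StrictMono x} = ⋂ i, ⋂ j, ⋂ _ : i < j, {x | x i < x j} := by
    ext x
    simp [StrictMono]
  rw [this]
  exact .iInter fun i => .iInter fun j => .iInter fun _ =>
    measurableSet_lt (measurable_pi_apply i) (measurable_pi_apply j)

/-- Each diagonal `x i = x j` is a proper linear subspace, hence Lebesgue null. -/
theorem ae_injective (ℓ : ℝ≥0∞) (n : ℕ) : ∀ᵐ x ∂(boxMeasure ℓ n), Function.Injective x := by
  have key : ∀ i j : Fin n, i ≠ j → ∀ᵐ x ∂(volume : Measure (Fin n → ℝ)), x i ≠ x j := by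
    intro i j hij
    let s : Submodule ℝ (Fin n → ℝ) :=
      LinearMap.ker (LinearMap.proj (R := ℝ) (φ := fun _ : Fin n => ℝ) i - LinearMap.proj j)
    have hs : s ≠ ⊤ := by
      intro h
      have : Pi.single i (1 : ℝ) ∈ s := h ▸ Submodule.mem_top
      simp [s, hij] at this
    have := Measure.addHaar_submodule volume s hs
    rw [ae_iff]
    convert this using 2
    ext x
    simp [s, sub_eq_zero]
  have h : ∀ᵐ x ∂(volume : Measure (Fin n → ℝ)), Function.Injective x := by
    have : ∀ᵐ x ∂(volume : Measure (Fin n → ℝ)), ∀ i j, i ≠ j → x i ≠ x j := by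
      rw [ae_all_iff]; intro i
      rw [ae_all_iff]; intro j
      by_cases hij : i = j
      · simp [hij]
      · simpa [hij] using key i j hij
    filter_upwards [this] with x hx i j h
    by_contra hij
    exact hx i j hij h
  rw [boxMeasure, ← Measure.restrict_pi_pi]
  exact ae_restrict_of_ae h

theorem exists_perm_strictMono {n : ℕ} {x : Fin n → ℝ} (hx : Function.Injective x) :
    ∃ σ : Equiv.Perm (Fin n), StrictMono (x ∘ σ) :=
  ⟨Tuple.sort x, (Tuple.monotone_sort x).strictMono_of_injective
    (hx.comp (Tuple.sort x).injective)⟩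

/-- The integral of a symmetric function is `n!` times the integral over ordered points. -/
theorem integral_eq_factorial_mul (ℓ : ℝ≥0∞) {n : ℕ} {f : (Fin n → ℝ) → ℂ}
    (hf : Integrable f (boxMeasure ℓ n))
    (hs : ∀ σ : Equiv.Perm (Fin n), (fun x => f (x ∘ σ)) =ᵐ[boxMeasure ℓ n] f) :
    ∫ x, f x ∂(boxMeasure ℓ n) =
      (n.factorial : ℂ) * ∫ x in {x : Fin n → ℝ | StrictMono x}, f x ∂(boxMeasure ℓ n) := by
  -- The `n!` chambers, one per ordering of the coordinates: they are disjoint, cover almost every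
  -- point, and carry equal integrals by symmetry.
  let s : Equiv.Perm (Fin n) → Set (Fin n → ℝ) :=
    fun σ => (fun x : Fin n → ℝ => x ∘ σ) ⁻¹' {x | StrictMono x}
  have hsm : ∀ σ, MeasurableSet (s σ) := fun σ =>
    (measurePreserving_permute ℓ σ).measurable (measurableSet_strictMono n)
  have hd : Pairwise (Function.onFun Disjoint s) := by
    intro σ τ hστ
    refine Set.disjoint_left.2 fun x hσ hτ => hστ ?_
    have hσ' : StrictMono (x ∘ σ) := hσ
    have hτ' : StrictMono (x ∘ τ) := hτ
    have hinj : Function.Injective x := by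
      have := hσ'.injective
      rwa [Equiv.injective_comp] at this
    -- A tuple has only one monotone rearrangement; injectivity of `x` then recovers the
    -- permutation.
    have h := Tuple.unique_monotone hσ'.monotone hτ'.monotone
    exact Equiv.ext fun i => hinj (congrFun h i)
  have hu : (⋃ σ, s σ : Set (Fin n → ℝ)) =ᵐ[boxMeasure ℓ n] Set.univ := by
    rw [Filter.eventuallyEq_univ]
    filter_upwards [ae_injective ℓ n] with x hx
    exact Set.mem_iUnion.2 (exists_perm_strictMono hx)
  have hint : ∀ σ, ∫ x in s σ, f x ∂(boxMeasure ℓ n) =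
      ∫ x in {x : Fin n → ℝ | StrictMono x}, f x ∂(boxMeasure ℓ n) := by
    intro σ
    have hp := measurePreserving_permute ℓ σ
    conv_rhs => rw [← hp.map_eq]
    rw [setIntegral_map (measurableSet_strictMono n)
      (by rw [hp.map_eq]; exact hf.aestronglyMeasurable) hp.measurable.aemeasurable]
    exact (integral_congr_ae (ae_restrict_of_ae (hs σ))).symm
  rw [← setIntegral_univ, ← setIntegral_congr_set hu,
    integral_iUnion_fintype hsm hd fun σ => hf.integrableOn]
  simp [hint, Fintype.card_perm]

/-! ### Matrix elements in one sector -/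

theorem nParticle_ae_symm {ℓ : ℝ≥0∞} {n : ℕ} (f : nParticle ℓ n) (σ : Equiv.Perm (Fin n)) :
    (fun x => (f : Lp ℂ 2 (boxMeasure ℓ n)) (x ∘ σ)) =ᵐ[boxMeasure ℓ n]
      (f : Lp ℂ 2 (boxMeasure ℓ n)) := by
  have h := Lp.coeFn_compMeasurePreserving (f : Lp ℂ 2 (boxMeasure ℓ n))
    (measurePreserving_permute ℓ σ)
  have hσ : Lp.compMeasurePreserving _ (measurePreserving_permute ℓ σ)
      (f : Lp ℂ 2 (boxMeasure ℓ n)) = f := f.2 σ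
  rw [hσ] at h
  exact h.symm

theorem amplitude_mul {ℓ : ℝ≥0∞} (Ψ Φ : Fock ℓ) (k : ℕ) :
    (fun x : Fin k → ℝ => (starRingEnd ℂ) (amplitude Ψ x) * amplitude Φ x) =
      fun x => (k.factorial : ℂ) * inner ℂ ((Ψ k : Lp ℂ 2 (boxMeasure ℓ k)) x)
        ((Φ k : Lp ℂ 2 (boxMeasure ℓ k)) x) := by
  funext x
  have h : (Real.sqrt k.factorial : ℂ) * (Real.sqrt k.factorial : ℂ) = k.factorial := by
    rw [← Complex.ofReal_mul, Real.mul_self_sqrt (by positivity)]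
    simp
  simp only [amplitude, map_mul, Complex.conj_ofReal, RCLike.inner_apply]
  rw [← h]
  ring

theorem integrable_amplitude_mul {ℓ : ℝ≥0∞} (Ψ Φ : Fock ℓ) (k : ℕ) :
    Integrable (fun x : Fin k → ℝ => (starRingEnd ℂ) (amplitude Ψ x) * amplitude Φ x)
      (boxMeasure ℓ k) := by
  rw [amplitude_mul]
  exact (L2.integrable_inner (𝕜 := ℂ) _ _).const_mul _

/-- The two factors `√k!` of the amplitudes compensate for integrating over one chamber out of `k!`.
-/
theorem setIntegral_amplitude_mul {ℓ : ℝ≥0∞} (Ψ Φ : Fock ℓ) (k : ℕ) :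
    ∫ x in {x : Fin k → ℝ | StrictMono x},
      (starRingEnd ℂ) (amplitude Ψ x) * amplitude Φ x ∂(boxMeasure ℓ k) =
      inner ℂ (Ψ k) (Φ k) := by
  rw [amplitude_mul, integral_const_mul, ← integral_eq_factorial_mul ℓ
    (L2.integrable_inner (𝕜 := ℂ) (Ψ k : Lp ℂ 2 (boxMeasure ℓ k)) _),
    Submodule.coe_inner, L2.inner_def]
  intro σ
  filter_upwards [nParticle_ae_symm (Ψ k) σ, nParticle_ae_symm (Φ k) σ] with x h1 h2
  rw [h1, h2]

/-! ### The Dyson series of a constant bulk tensor -/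

theorem amplitude_comp_cast {ℓ : ℝ≥0∞} (Φ : Fock ℓ) {k n : ℕ} (h : k = n) (x : Fin n → ℝ) :
    amplitude Φ (fun i : Fin k => x (Fin.cast h i)) = amplitude Φ x := by
  subst h
  rfl

theorem amplitude_subTuple_of_eq_univ {ℓ : ℝ≥0∞} (Φ : Fock ℓ) {n : ℕ} (x : Fin n → ℝ)
    {s : Finset (Fin n)} (hs : s = Finset.univ) :
    amplitude Φ (subTuple x s) = amplitude Φ x := by
  have hc : s.card = n := by simp [hs]
  rw [← amplitude_comp_cast Φ hc x]
  congr 1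
  funext i
  -- The increasing enumeration of all positions can only be the identity, up to the cast `s.card =
  -- n`.
  have := Finset.orderEmbOfFin_unique (s := s) rfl (f := Fin.cast hc) (by simp [hs])
    (Fin.cast_strictMono hc)
  rw [subTuple, ← this]

section
variable {ℓ : ℝ≥0∞} {ι : Type} [Fintype ι] [DecidableEq ι] (B T : Matrix ι ι ℂ)

theorem dysonIntegrand_T (Ψ Φ : Fock ℓ) (n : ℕ) :
    dysonIntegrand B (fun _ => 0) (fun _ => 0) (fun _ => 0) (fun _ => T) Ψ Φ
      (fun _ : Fin n => Letter.T) =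
    fun x => (B * T ^ n).trace * ((starRingEnd ℂ) (amplitude Ψ x) * amplitude Φ x) := by
  funext x
  simp only [dysonIntegrand, Letter.bond, List.ofFn_const, List.prod_replicate]
  rw [amplitude_subTuple_of_eq_univ Ψ x (by simp [Letter.creates]),
    amplitude_subTuple_of_eq_univ Φ x (by simp [Letter.annihilates])]

theorem dysonIntegrand_of_ne_T (Ψ Φ : Fock ℓ) {n : ℕ} {α : Fin n → Letter}
    (hα : α ≠ fun _ => Letter.T) :
    dysonIntegrand B (fun _ => 0) (fun _ => 0) (fun _ => 0) (fun _ => T) Ψ Φ α = 0 := by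
  funext x
  obtain ⟨i, hi⟩ := Function.ne_iff.1 hα
  have h0 : (List.ofFn fun i => (α i).bond (fun _ => (0 : Matrix ι ι ℂ)) (fun _ => 0)
      (fun _ => 0) (fun _ => T) (x i)).prod = 0 := by
    refine List.prod_eq_zero (List.mem_ofFn.2 ⟨i, ?_⟩)
    cases h : α i <;> simp_all [Letter.bond]
  simp [dysonIntegrand, h0]

/-- Only one word of each length survives, so the sum over words reindexes to a sum over lengths. -/
theorem hasSum_dyson_iff (Ψ Φ : Fock ℓ) (a : ℂ) :
    HasSum (fun w : (n : ℕ) × (Fin n → Letter) =>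
        ∫ x in {x : Fin w.1 → ℝ | StrictMono x},
          dysonIntegrand B (fun _ => 0) (fun _ => 0) (fun _ => 0) (fun _ => T) Ψ Φ w.2 x
            ∂(boxMeasure ℓ w.1)) a ↔
      HasSum (fun n => (B * T ^ n).trace * inner ℂ (Ψ n) (Φ n)) a := by
  have hinj : Function.Injective
      (fun n => ⟨n, fun _ => Letter.T⟩ : ℕ → (n : ℕ) × (Fin n → Letter)) :=
    fun m n h => congrArg Sigma.fst h
  rw [← hinj.hasSum_iff]
  · refine iff_of_eq (congrArg (fun f => HasSum f a) (funext fun n => ?_))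
    simp only [Function.comp_apply, dysonIntegrand_T, integral_const_mul,
      setIntegral_amplitude_mul]
  · rintro ⟨n, α⟩ h
    have hα : α ≠ fun _ => Letter.T := fun h' => h ⟨n, by rw [h']⟩
    simp [dysonIntegrand_of_ne_T B T Ψ Φ hα]

theorem isCMPO_of_hasSum {O : Fock ℓ →L[ℂ] Fock ℓ}
    (hO : ∀ Ψ Φ, HasSum (fun n => (B * T ^ n).trace * inner ℂ (Ψ n) (Φ n)) (inner ℂ Ψ (O Φ))) :
    IsCMPO ℓ B (fun _ => 0) (fun _ => 0) (fun _ => 0) (fun _ => T) O := by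
  refine fun Ψ Φ _ _ => ⟨fun n α => ?_, (hasSum_dyson_iff B T Ψ Φ _).2 (hO Ψ Φ)⟩
  by_cases hα : α = fun _ => Letter.T
  · rw [hα, dysonIntegrand_T]
    exact ((integrable_amplitude_mul Ψ Φ n).const_mul _).integrableOn
  · rw [dysonIntegrand_of_ne_T B T Ψ Φ hα]
    exact integrableOn_zero

theorem propagator_zero (S : Set ℝ) : propagator (fun _ => (0 : Matrix ι ι ℂ)) S = 1 := by
  ext a b
  rw [propagator, Matrix.of_apply, tsum_eq_single 0]
  -- The empty word integrates the identity over the one-point space `Fin 0 → ℝ`, of mass one.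
  · simp [StrictMono, measureReal_def, volume_pi]
  · intro n hn
    simp [List.ofFn_const, List.prod_replicate, hn]

theorem phaseCoeff_const {j : ℕ} (x : Fin j → ℝ) :
    phaseCoeff ℓ B (fun _ => 0) (fun _ => T) x = (B * T ^ j).trace := by
  simp [phaseCoeff, propagator_zero, List.ofFn_const, List.prod_replicate]

end

/-! ### Density of the states of finite particle number -/

theorem finiteParticle_single {ℓ : ℝ≥0∞} (n : ℕ) (f : nParticle ℓ n) :
    FiniteParticle (lp.single 2 n f : Fock ℓ) := by
  refine (Set.finite_singleton n).subset fun m hm => ?_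
  by_contra h
  exact hm (lp.single_apply_ne (E := fun n => nParticle ℓ n) 2 n f h)

/-- Testing against single-sector states determines each component of `O` on such a state; every
state is a convergent sum of them, and `O`, `O'` are continuous. -/
theorem eq_of_inner_single {ℓ : ℝ≥0∞} {O O' : Fock ℓ →L[ℂ] Fock ℓ}
    (h : ∀ m n (f : nParticle ℓ m) (g : nParticle ℓ n),
      inner ℂ (lp.single 2 m f : Fock ℓ) (O (lp.single 2 n g)) =
        inner ℂ (lp.single 2 m f : Fock ℓ) (O' (lp.single 2 n g))) : O = O' := by
  have h1 : ∀ n (g : nParticle ℓ n), O (lp.single 2 n g) = O' (lp.single 2 n g) := by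
    intro n g
    refine lp.ext (funext fun m => ext_inner_left ℂ fun f => ?_)
    simpa [lp.inner_single_left] using h m n f g
  ext1 Φ
  have hΦ := lp.hasSum_single ENNReal.ofNat_ne_top Φ
  refine (O.hasSum hΦ).unique ?_
  simpa [Function.comp_def, h1] using O'.hasSum hΦ

theorem IsCMPO.unique {ℓ : ℝ≥0∞} {ι : Type} [Fintype ι] [DecidableEq ι]
    {B : Matrix ι ι ℂ} {Q L R T : ℝ → Matrix ι ι ℂ} {O O' : Fock ℓ →L[ℂ] Fock ℓ}
    (h : IsCMPO ℓ B Q L R T O) (h' : IsCMPO ℓ B Q L R T O') : O = O' :=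
  eq_of_inner_single fun m n f g =>
    (h _ _ (finiteParticle_single m f) (finiteParticle_single n g)).2.unique
      (h' _ _ (finiteParticle_single m f) (finiteParticle_single n g)).2

/-! ### The number-controlled phase -/

theorem sectorProj_eq_single (ℓ : ℝ≥0∞) (k : ℕ) (Φ : Fock ℓ) :
    sectorProj ℓ k Φ = lp.single 2 k (Φ k) := by
  refine Submodule.eq_starProjection_of_mem_orthogonal
    (fun n hn => lp.single_apply_ne 2 k _ hn) ?_
  rw [Submodule.mem_orthogonal]
  intro Ψ hΨ
  refine (lp.hasSum_inner Ψ _).unique ?_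
  suffices h : ∀ n, inner ℂ (Ψ n) ((Φ - lp.single 2 k (Φ k) : Fock ℓ) n) = 0 by
    simpa only [h] using hasSum_zero
  -- In sector `k` the remainder vanishes; in every other sector `Ψ` does.
  intro n
  by_cases hn : n = k
  · subst hn
    simp
  · rw [hΨ n hn, inner_zero_left]

theorem sectorProj_apply (ℓ : ℝ≥0∞) (k : ℕ) (Φ : Fock ℓ) (n : ℕ) :
    sectorProj ℓ k Φ n = if n = k then Φ n else 0 := by
  rw [sectorProj_eq_single]
  split_ifs with h
  · subst h
    simp
  · exact lp.single_apply_ne 2 k _ h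

theorem isOrderedAd_sectorProj (ℓ : ℝ≥0∞) (k : ℕ) : IsOrderedAd ℓ k (sectorProj ℓ k) := by
  refine fun Ψ Φ => ⟨(integrable_amplitude_mul Ψ Φ k).integrableOn, ?_⟩
  rw [setIntegral_amplitude_mul, sectorProj_eq_single, lp.inner_single_right]

/-- The operator that multiplies the `k`-particle sector by `e^{iθ}`. -/
noncomputable def sectorPhase (ℓ : ℝ≥0∞) (k : ℕ) (θ : ℝ) : Fock ℓ →L[ℂ] Fock ℓ :=
  1 + (Complex.exp (Complex.I * θ) - 1) • sectorProj ℓ k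

theorem sectorPhase_apply (ℓ : ℝ≥0∞) (k : ℕ) (θ : ℝ) (Φ : Fock ℓ) (n : ℕ) :
    sectorPhase ℓ k θ Φ n = if n = k then Complex.exp (Complex.I * θ) • Φ n else Φ n := by
  have : sectorPhase ℓ k θ Φ n =
      Φ n + (Complex.exp (Complex.I * θ) - 1) • sectorProj ℓ k Φ n := rfl
  rw [this, sectorProj_apply]
  split_ifs
  · rw [sub_smul, one_smul, add_sub_cancel]
  · simp

/-- The group law in `θ`, together with `star_sectorPhase`, yields unitarity. -/
theorem sectorPhase_mul (ℓ : ℝ≥0∞) (k : ℕ) (θ θ' : ℝ) :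
    sectorPhase ℓ k θ * sectorPhase ℓ k θ' = sectorPhase ℓ k (θ + θ') := by
  ext1 Φ
  refine lp.ext (funext fun n => ?_)
  rw [mul_apply_eq_comp]
  simp only [sectorPhase_apply]
  split_ifs
  · rw [smul_smul, ← Complex.exp_add]
    push_cast
    rw [mul_add]
  · rfl

theorem sectorPhase_zero (ℓ : ℝ≥0∞) (k : ℕ) : sectorPhase ℓ k 0 = 1 := by
  simp [sectorPhase]

theorem star_sectorPhase (ℓ : ℝ≥0∞) (k : ℕ) (θ : ℝ) :
    star (sectorPhase ℓ k θ) = sectorPhase ℓ k (-θ) := by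
  symm
  rw [ContinuousLinearMap.star_eq_adjoint, ContinuousLinearMap.eq_adjoint_iff]
  intro Φ Ψ
  refine (lp.hasSum_inner _ Ψ).unique ?_
  suffices h : ∀ n, inner ℂ (sectorPhase ℓ k (-θ) Φ n) (Ψ n) =
      inner ℂ (Φ n) (sectorPhase ℓ k θ Ψ n) by
    simpa only [h] using lp.hasSum_inner Φ (sectorPhase ℓ k θ Ψ)
  intro n
  simp only [sectorPhase_apply]
  split_ifs
  · refine (inner_smul_left (Φ n) (Ψ n) _).trans
      (Eq.trans ?_ (inner_smul_right (Φ n) (Ψ n) _).symm)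
    rw [← Complex.exp_conj]
    simp
  · rfl

theorem sectorPhase_mem_unitary (ℓ : ℝ≥0∞) (k : ℕ) (θ : ℝ) :
    sectorPhase ℓ k θ ∈ unitary (Fock ℓ →L[ℂ] Fock ℓ) := by
  rw [Unitary.mem_iff, star_sectorPhase, sectorPhase_mul, sectorPhase_mul]
  simp [sectorPhase_zero]

/-- Stated for arbitrary tensors with the right traces, so that it covers the given tensors and all
their gauge transforms at once. -/
theorem isPhaseCMPU_sectorPhase (ℓ : ℝ≥0∞) (k : ℕ) (θ : ℝ) {ι : Type} [Fintype ι]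
    [DecidableEq ι] {B T : Matrix ι ι ℂ}
    (h : ∀ n, (B * T ^ n).trace = if n = k then Complex.exp (Complex.I * θ) else 1) :
    IsPhaseCMPU ℓ B (fun _ => 0) (fun _ => T) (sectorPhase ℓ k θ) where
  mem_unitary := sectorPhase_mem_unitary ℓ k θ
  isCMPO := by
    refine isCMPO_of_hasSum B T fun Ψ Φ => ?_
    suffices hn : ∀ n, (B * T ^ n).trace * inner ℂ (Ψ n) (Φ n) =
        inner ℂ (Ψ n) (sectorPhase ℓ k θ Φ n) by
      simpa only [hn] using lp.hasSum_inner Ψ (sectorPhase ℓ k θ Φ)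
    intro n
    rw [h, sectorPhase_apply]
    split_ifs
    · exact (inner_smul_right (Ψ n) (Φ n) _).symm
    · rw [one_mul]
  isPhase := by
    refine ⟨fun j _ => if j = k then θ else 0, fun j x _ _ => ?_⟩
    rw [phaseCoeff_const, h]
    by_cases hj : j = k <;> simp [hj]

end CMPO

theorem mainTheorem7 (D : ℕ) (hD : 2 ≤ D) (θ : ℝ) (ℓ : ENNReal) (hℓ : 0 < ℓ) :
    ∃ U : CMPO.Fock ℓ →L[ℂ] CMPO.Fock ℓ,
      CMPO.IsBulkUniformPhaseCMPU (D + 1) ℓ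
        (CMPO.numberBoundary D θ) 0 (CMPO.numberBulk D) U ∧
      (∀ U' : CMPO.Fock ℓ →L[ℂ] CMPO.Fock ℓ,
        CMPO.IsCMPO ℓ (CMPO.numberBoundary D θ) (fun _ => 0) (fun _ => 0) (fun _ => 0)
          (fun _ => CMPO.numberBulk D) U' → U' = U) ∧
      (∀ g : Matrix.GeneralLinearGroup (Fin (D + 1)) ℂ,
        CMPO.IsBulkUniformPhaseCMPU (D + 1) ℓ
          (g.val * CMPO.numberBoundary D θ * g⁻¹.val) 0
          (g.val * CMPO.numberBulk D * g⁻¹.val) U) ∧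
      CMPO.numberBoundary D θ =
        CMPO.oneOplus ((Complex.exp (Complex.I * θ) - 1) •
          (CMPO.nilShift D).transpose ^ (D - 1)) ∧
      U = 1 + (Complex.exp (Complex.I * θ) - 1) • CMPO.sectorProj ℓ (D - 1) ∧
      CMPO.IsOrderedAd ℓ (D - 1) (CMPO.sectorProj ℓ (D - 1)) ∧
      ∀ (Φ : CMPO.Fock ℓ) (n : ℕ),
        U Φ n = if n = D - 1 then Complex.exp (Complex.I * θ) • Φ n else Φ n := by
  -- With `D = n + 1`, the distinguished particle number `D - 1` is `n`.
  obtain ⟨n, rfl⟩ : ∃ n, D = n + 1 := ⟨D - 1, by omega⟩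
  rw [Nat.add_sub_cancel]
  have hU := CMPO.isPhaseCMPU_sectorPhase ℓ n θ (fun k => CMPO.trace_number n k θ)
  exact ⟨CMPO.sectorPhase ℓ n θ, hU, fun U' hU' => hU'.unique hU.isCMPO,
    fun g => CMPO.isPhaseCMPU_sectorPhase ℓ n θ fun k => by
      rw [CMPO.trace_conj_mul_pow, CMPO.trace_number],
    CMPO.numberBoundary_eq n θ, rfl, CMPO.isOrderedAd_sectorProj ℓ n,
    CMPO.sectorPhase_apply ℓ n θ⟩
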